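/- Let $N\ge 2$ be an integer and $0<\gamma<1$. Let $y_1,\dots,y_N$ be independent random variables, each normally distributed with mean $m\in\mathbb R$ and standard deviation $\sigma>0$, and put $$\tilde y=\frac1N\sum_{k=1}^N y_k,\qquad \tilde\sigma=\sqrt{\frac1{N-1}\sum_{k=1}^N (y_k-\tilde y)^2}.$$ For $\lambda>0$ let $$\mathcal A_\lambda=\frac1{\sqrt{2\pi}\,\sigma}\int_{\tilde y-\lambda\tilde\sigma}^{\tilde y+\lambda\tilde\sigma} e^{-(t-m)^2/(2\sigma^2)}\,dt$$ be the (random) fraction of the distribution $N(m,\sigma)$ contained in the interval $[\tilde y-\lambda\tilde\sigma,\ \tilde y+\lambda\tilde\sigma]$. For every $\mu\in\mathbb R$ the equation $$\frac1{\sqrt{2\pi}}\int_{\mu-q}^{\mu+q}e^{-x^2/2}\,dx=\gamma$$ has exactly one real solution $q=q(\mu,\gamma)$, and this solution is positive. For $n\ge 1$ and $x\ge 0$ let $$K_n(x)=\frac1{2\Gamma(n/2)}\int_0^x\Big(\frac u2\Big)^{(n-2)/2}e^{-u/2}\,du$$ be the distribution function of the $\chi^2$ distribution with $n$ degrees of freedom.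 Then for every $\lambda>0$ the integral below converges and $$\mathbb P\{\mathcal A_\lambda>\gamma\}=W(\lambda,\gamma,N):=1-\sqrt{\frac N{2\pi}}\int_{-\infty}^{+\infty}K_{N-1}\!\left[(N-1)\Big(\frac{q(\mu,\gamma)}{\lambda}\Big)^2\right]e^{-N\mu^2/2}\,d\mu ,$$ whatever $m$ and $\sigma$ are. The function $\lambda\mapsto W(\lambda,\gamma,N)$ is strictly increasing on $(0,\infty)$. For every $0<\beta<1$ the equation $W(\lambda,\gamma,N)=\beta$ has exactly one root $\lambda_0>0$. It does not depend on $m$ and $\sigma$, and for every normal sample as above and every $\lambda>0$ one has $\mathbb P\{\mathcal A_\lambda>\gamma\}=\beta$ if and only if $\lambda=\lambda_0$. -/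

import Mathlib

open MeasureTheory ProbabilityTheory

universe u

namespace NormalTolerance

noncomputable section

/-- The sample mean `(1/N) ∑ yₖ`. -/
def sampleMean {N : ℕ} (y : Fin N → ℝ) : ℝ :=
  (1 / (N : ℝ)) * ∑ k, y k

/-- The (positive root of the) unbiased sample variance `(1/(N-1)) ∑ (yₖ - mean)²`. -/
def sampleSD {N : ℕ} (y : Fin N → ℝ) : ℝ :=
  √((1 / ((N : ℝ) - 1)) * ∑ k, (y k - sampleMean y) ^ 2)

/-- The probability content of the interval `[mean - lam * sd, mean + lam * sd]` under the
normal distribution with mean `m` and standard deviation `σ`. -/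
def content {N : ℕ} (m σ lam : ℝ) (y : Fin N → ℝ) : ℝ :=
  (gaussianReal m (σ ^ 2).toNNReal).real
    (Set.Icc (sampleMean y - lam * sampleSD y) (sampleMean y + lam * sampleSD y))

/-- `y 0, …, y (N-1)` are independent random variables on the probability space `(Ω, P)`, all of
them normally distributed with mean `m` and standard deviation `σ`. -/
structure IsNormalSample {Ω : Type u} [MeasurableSpace Ω] (P : Measure Ω) {N : ℕ}
    (y : Fin N → Ω → ℝ) (m σ : ℝ) : Prop where
  isProbabilityMeasure : IsProbabilityMeasure P
  sd_pos : 0 < σ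
  hasLaw : ∀ k, HasLaw (y k) (gaussianReal m (σ ^ 2).toNNReal) P
  indep : iIndepFun y P

/-- The distribution function of the `χ²` distribution with `n ≥ 1` degrees of freedom
(it is `0` for `x ≤ 0`). -/
def chiSquaredCDF (n : ℕ) (x : ℝ) : ℝ :=
  1 / (2 * Real.Gamma ((n : ℝ) / 2)) *
    ∫ u in Set.Ioc 0 x, (u / 2) ^ (((n : ℝ) - 2) / 2) * Real.exp (-u / 2)

/-- `(1/√(2π)) ∫_{μ-q}^{μ+q} e^{-x²/2} dx`. -/
def normalMass (μ q : ℝ) : ℝ :=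
  1 / √(2 * Real.pi) * ∫ x in (μ - q)..(μ + q), Real.exp (-x ^ 2 / 2)

/-- The solution `q` of the equation `normalMass μ q = γ`. -/
def halfWidth (μ γ : ℝ) : ℝ :=
  Classical.epsilon fun q => normalMass μ q = γ

/-- The integrand in the definition of `W`. -/
def integrandW (lam γ : ℝ) (N : ℕ) (μ : ℝ) : ℝ :=
  chiSquaredCDF (N - 1) (((N : ℝ) - 1) * (halfWidth μ γ / lam) ^ 2) *
    Real.exp (-(N : ℝ) * μ ^ 2 / 2)

/-- `W(lam, γ, N)`. -/
def W (lam γ : ℝ) (N : ℕ) : ℝ :=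
  1 - √((N : ℝ) / (2 * Real.pi)) * ∫ μ, integrandW lam γ N μ

end

end NormalTolerance

/-! Standardising the sample removes `m` and `σ`: the content exceeds `γ` iff q(mean z) < λ · sd z
for a standard normal sample z, since normal mass is strictly increasing in the half-width
(`IsNormalSample.real_lt_content`). In an orthonormal basis whose first vector is constant, the mean
is w₀/√N and the sum of squared deviations is the sum of the other N - 1 squared coordinates. By
rotation invariance the coordinates w are again standard normal, so the mean is N(0,
1/N)-distributed and independent of a χ² variable with N - 1 degrees of freedom
(`map_sampleMean_sum_sq`). Fubini over the mean then gives `W`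
(`pi_gaussianReal_real_halfWidth_lt`). As a function of t = 1/λ, the quantity 1 - W is an average of
χ² distribution functions at (N - 1)(q t)². It is continuous and strictly increasing from 0 at t = 0
to the limit 1, so each level in (0, 1) is attained exactly once. -/

namespace NormalTolerance

/-! ### Normal mass of an interval and its inverse, the half-width -/

lemma gaussianPDFReal_zero_one (x : ℝ) :
    gaussianPDFReal 0 1 x = 1 / √(2 * Real.pi) * Real.exp (-x ^ 2 / 2) := by
  simp [gaussianPDFReal]

lemma normalMass_eq_integral_gaussianPDFReal (μ q : ℝ) :
    normalMass μ q = ∫ x in (μ - q)..(μ + q), gaussianPDFReal 0 1 x := by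
  simp only [normalMass, gaussianPDFReal_zero_one]
  rw [intervalIntegral.integral_const_mul]

lemma intervalIntegrable_gaussianPDFReal (a b : ℝ) :
    IntervalIntegrable (gaussianPDFReal 0 1) volume a b :=
  (integrable_gaussianPDFReal 0 1).intervalIntegrable

lemma normalMass_eq_sub (μ q : ℝ) :
    normalMass μ q = (∫ x in (0 : ℝ)..(μ + q), gaussianPDFReal 0 1 x) -
      ∫ x in (0 : ℝ)..(μ - q), gaussianPDFReal 0 1 x := by
  rw [normalMass_eq_integral_gaussianPDFReal, intervalIntegral.integral_interval_sub_left] <;>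
    exact intervalIntegrable_gaussianPDFReal _ _

lemma strictMono_integral_gaussianPDFReal :
    StrictMono fun b : ℝ => ∫ x in (0 : ℝ)..b, gaussianPDFReal 0 1 x := by
  intro a b hab
  have h : (∫ x in (0 : ℝ)..b, gaussianPDFReal 0 1 x) - (∫ x in (0 : ℝ)..a, gaussianPDFReal 0 1 x) =
      ∫ x in a..b, gaussianPDFReal 0 1 x :=
    intervalIntegral.integral_interval_sub_left (intervalIntegrable_gaussianPDFReal _ _)
      (intervalIntegrable_gaussianPDFReal _ _)
  have : 0 < ∫ x in a..b, gaussianPDFReal 0 1 x :=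
    intervalIntegral.intervalIntegral_pos_of_pos (intervalIntegrable_gaussianPDFReal _ _)
      (fun x => gaussianPDFReal_pos 0 1 x one_ne_zero) hab
  linarith

lemma continuous_integral_gaussianPDFReal :
    Continuous fun b : ℝ => ∫ x in (0 : ℝ)..b, gaussianPDFReal 0 1 x :=
  intervalIntegral.continuous_primitive intervalIntegrable_gaussianPDFReal 0

lemma continuous_normalMass : Continuous fun p : ℝ × ℝ => normalMass p.1 p.2 := by
  simp only [normalMass_eq_sub]
  exact (continuous_integral_gaussianPDFReal.comp (continuous_fst.add continuous_snd)).sub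
    (continuous_integral_gaussianPDFReal.comp (continuous_fst.sub continuous_snd))

lemma strictMono_normalMass (μ : ℝ) : StrictMono (normalMass μ) := by
  intro a b hab
  rw [normalMass_eq_sub, normalMass_eq_sub]
  have h1 := strictMono_integral_gaussianPDFReal (show μ + a < μ + b by linarith)
  have h2 := strictMono_integral_gaussianPDFReal (show μ - b < μ - a by linarith)
  simp only at h1 h2
  linarith

lemma normalMass_zero (μ : ℝ) : normalMass μ 0 = 0 := by simp [normalMass]

open Filter Topology in
lemma tendsto_normalMass_atTop (μ : ℝ) : Tendsto (normalMass μ) atTop (𝓝 1) := by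
  rw [← integral_gaussianPDFReal_eq_one 0 one_ne_zero]
  rw [show normalMass μ = _ from funext (normalMass_eq_integral_gaussianPDFReal μ)]
  refine intervalIntegral_tendsto_integral (integrable_gaussianPDFReal 0 1) ?_ ?_
  · exact (tendsto_atBot_add_const_left _ μ tendsto_neg_atTop_atBot).congr
      fun q => (sub_eq_add_neg μ q).symm
  · exact tendsto_atTop_add_const_left _ _ tendsto_id

lemma exists_normalMass_eq (μ : ℝ) {γ : ℝ} (hγ0 : 0 < γ) (hγ1 : γ < 1) :
    ∃ q, normalMass μ q = γ := by
  obtain ⟨b, hb0, hb⟩ := (((tendsto_normalMass_atTop μ).eventually_const_lt hγ1).and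
    (Filter.eventually_ge_atTop 0)).exists
  have hc : Continuous (normalMass μ) :=
    continuous_normalMass.comp (continuous_const.prodMk continuous_id)
  obtain ⟨q, -, hq⟩ := intermediate_value_Icc hb hc.continuousOn
    (show γ ∈ Set.Icc (normalMass μ 0) (normalMass μ b) from
      ⟨by rw [normalMass_zero]; exact hγ0.le, hb0.le⟩)
  exact ⟨q, hq⟩

lemma normalMass_halfWidth (μ : ℝ) {γ : ℝ} (hγ0 : 0 < γ) (hγ1 : γ < 1) :
    normalMass μ (halfWidth μ γ) = γ :=
  Classical.epsilon_spec (exists_normalMass_eq μ hγ0 hγ1)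

lemma normalMass_eq_iff (μ q : ℝ) {γ : ℝ} (hγ0 : 0 < γ) (hγ1 : γ < 1) :
    normalMass μ q = γ ↔ q = halfWidth μ γ := by
  conv_lhs => rw [← normalMass_halfWidth μ hγ0 hγ1]
  exact (strictMono_normalMass μ).injective.eq_iff

lemma lt_normalMass_iff (μ q : ℝ) {γ : ℝ} (hγ0 : 0 < γ) (hγ1 : γ < 1) :
    γ < normalMass μ q ↔ halfWidth μ γ < q := by
  conv_lhs => rw [← normalMass_halfWidth μ hγ0 hγ1]
  exact (strictMono_normalMass μ).lt_iff_lt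

lemma halfWidth_pos (μ : ℝ) {γ : ℝ} (hγ0 : 0 < γ) (hγ1 : γ < 1) : 0 < halfWidth μ γ := by
  rw [← (strictMono_normalMass μ).lt_iff_lt, normalMass_zero, normalMass_halfWidth μ hγ0 hγ1]
  exact hγ0

/-- Monotonicity in `q` turns {q(μ) < c} into a superlevel set of the continuous map μ ↦ `normalMass
μ c`, which is open. -/
lemma measurable_halfWidth {γ : ℝ} (hγ0 : 0 < γ) (hγ1 : γ < 1) :
    Measurable fun μ => halfWidth μ γ := by
  refine measurable_of_Iio fun c => ?_
  have : (fun μ => halfWidth μ γ) ⁻¹' Set.Iio c = {μ | γ < normalMass μ c} := by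
    ext μ
    exact (lt_normalMass_iff μ c hγ0 hγ1).symm
  rw [this]
  exact (isOpen_lt continuous_const
    (continuous_normalMass.comp (continuous_id.prodMk continuous_const))).measurableSet

lemma gaussianReal_real_Icc_eq_normalMass (μ : ℝ) {q : ℝ} (hq : 0 ≤ q) :
    (gaussianReal 0 1).real (Set.Icc (μ - q) (μ + q)) = normalMass μ q := by
  have h0 : 0 ≤ ∫ x in Set.Icc (μ - q) (μ + q), gaussianPDFReal 0 1 x :=
    integral_nonneg fun x => gaussianPDFReal_nonneg 0 1 x
  rw [Measure.real, gaussianReal_apply_eq_integral _ one_ne_zero, ENNReal.toReal_ofReal h0,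
    normalMass_eq_integral_gaussianPDFReal, intervalIntegral.integral_of_le (by linarith),
    integral_Icc_eq_integral_Ioc]

lemma gaussianReal_eq_map (m σ : ℝ) :
    gaussianReal m (σ ^ 2).toNNReal = (gaussianReal 0 1).map (fun x => m + σ * x) := by
  have h : (fun x : ℝ => m + σ * x) = (fun x => m + x) ∘ (fun x => σ * x) := rfl
  rw [h, ← Measure.map_map (by fun_prop) (by fun_prop), gaussianReal_map_const_mul,
    gaussianReal_map_const_add]
  congr 1
  · simp
  · ext; simp [sq_nonneg]

lemma gaussianReal_real_Icc {m σ : ℝ} (hσ : 0 < σ) (a b : ℝ) :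
    (gaussianReal m (σ ^ 2).toNNReal).real (Set.Icc (m + σ * a) (m + σ * b)) =
      (gaussianReal 0 1).real (Set.Icc a b) := by
  rw [gaussianReal_eq_map, map_measureReal_apply (by fun_prop) measurableSet_Icc]
  congr 1
  ext x
  simp [hσ]

/-! ### The χ² distribution function -/

/-- χ² is the gamma law of shape n/2 and rate 1/2; the bounds and the limit at infinity follow from
this. -/
lemma chiSquaredCDF_eq_cdf {n : ℕ} (hn : n ≠ 0) (x : ℝ) :
    chiSquaredCDF n x = cdf (gammaMeasure ((n : ℝ) / 2) (1 / 2)) x := by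
  have hn' : (0 : ℝ) < n := by positivity
  rw [cdf_gammaMeasure_eq_integral (by positivity) (by norm_num), chiSquaredCDF,
    ← integral_const_mul, ← integral_indicator measurableSet_Ioc,
    ← integral_indicator measurableSet_Iic]
  refine integral_congr_ae ?_
  -- The integrands can differ at u = 0: for n = 2 the gamma density is nonzero there, while `Ioc`
  -- excludes the point.
  filter_upwards [compl_mem_ae_iff.2 (measure_singleton (0 : ℝ))] with u hu
  have hu0 : u ≠ 0 := hu
  by_cases h : u ≤ x
  · rcases lt_or_gt_of_ne hu0 with h0 | h0
    · simp [Set.indicator, h, h0.not_ge, h0.not_gt, gammaPDFReal]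
    · have e1 : ((n : ℝ) - 2) / 2 = n / 2 - 1 := by ring
      have e2 : (1 / 2 : ℝ) ^ ((n : ℝ) / 2) = (1 / 2) ^ ((n : ℝ) / 2 - 1) * (1 / 2) := by
        rw [Real.rpow_sub_one (by norm_num)]; ring
      have e3 : (u / 2) ^ ((n : ℝ) / 2 - 1) =
          u ^ ((n : ℝ) / 2 - 1) * (1 / 2) ^ ((n : ℝ) / 2 - 1) := by
        rw [← Real.mul_rpow h0.le (by norm_num)]; ring_nf
      have e4 : -u / 2 = -(1 / 2 * u) := by ring
      simp only [Set.indicator, Set.mem_Ioc, h, h0, and_self, if_true, Set.mem_Iic, gammaPDFReal,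
        h0.le, e1, e2, e3, e4]
      field_simp
  · simp [Set.indicator, h]

lemma chiSquaredCDF_nonneg {n : ℕ} (hn : n ≠ 0) (x : ℝ) : 0 ≤ chiSquaredCDF n x := by
  rw [chiSquaredCDF_eq_cdf hn]; exact cdf_nonneg _ _

lemma chiSquaredCDF_le_one {n : ℕ} (hn : n ≠ 0) (x : ℝ) : chiSquaredCDF n x ≤ 1 := by
  rw [chiSquaredCDF_eq_cdf hn]; exact cdf_le_one _ _

open Filter Topology in
lemma tendsto_chiSquaredCDF_atTop {n : ℕ} (hn : n ≠ 0) :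
    Tendsto (chiSquaredCDF n) atTop (𝓝 1) := by
  rw [funext (chiSquaredCDF_eq_cdf hn)]; exact tendsto_cdf_atTop _

lemma chiSquaredCDF_zero (n : ℕ) : chiSquaredCDF n 0 = 0 := by simp [chiSquaredCDF]

lemma integrable_gammaPDFReal {a r : ℝ} (ha : 0 < a) (hr : 0 < r) :
    Integrable (gammaPDFReal a r) := by
  refine ⟨(measurable_gammaPDFReal a r).aestronglyMeasurable, ?_⟩
  rw [hasFiniteIntegral_iff_ofReal (ae_of_all _ (gammaPDFReal_nonneg ha hr))]
  exact (lintegral_gammaPDF_eq_one ha hr).trans_lt ENNReal.one_lt_top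

lemma chiSquaredCDF_sub_eq {n : ℕ} (hn : n ≠ 0) (x y : ℝ) :
    chiSquaredCDF n y - chiSquaredCDF n x =
      ∫ u in x..y, gammaPDFReal ((n : ℝ) / 2) (1 / 2) u := by
  have hi := integrable_gammaPDFReal (a := (n : ℝ) / 2) (r := 1 / 2) (by positivity) (by norm_num)
  rw [chiSquaredCDF_eq_cdf hn, chiSquaredCDF_eq_cdf hn,
    cdf_gammaMeasure_eq_integral (by positivity) (by norm_num),
    cdf_gammaMeasure_eq_integral (by positivity) (by norm_num),
    intervalIntegral.integral_Iic_sub_Iic hi.integrableOn hi.integrableOn]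

lemma continuous_chiSquaredCDF {n : ℕ} (hn : n ≠ 0) : Continuous (chiSquaredCDF n) := by
  have hi := integrable_gammaPDFReal (a := (n : ℝ) / 2) (r := 1 / 2) (by positivity) (by norm_num)
  have : chiSquaredCDF n = fun y => ∫ u in (0 : ℝ)..y, gammaPDFReal ((n : ℝ) / 2) (1 / 2) u := by
    ext y
    rw [← chiSquaredCDF_sub_eq hn, chiSquaredCDF_zero, sub_zero]
  rw [this]
  exact intervalIntegral.continuous_primitive (fun _ _ => hi.intervalIntegrable) 0

lemma strictMonoOn_chiSquaredCDF {n : ℕ} (hn : n ≠ 0) :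
    StrictMonoOn (chiSquaredCDF n) (Set.Ici 0) := by
  intro x hx y _ hxy
  have hi := integrable_gammaPDFReal (a := (n : ℝ) / 2) (r := 1 / 2) (by positivity) (by norm_num)
  have : 0 < ∫ u in x..y, gammaPDFReal ((n : ℝ) / 2) (1 / 2) u :=
    intervalIntegral.intervalIntegral_pos_of_pos_on hi.intervalIntegrable
      (fun u hu => gammaPDFReal_pos (by positivity) (by norm_num)
        (lt_of_le_of_lt hx hu.1)) hxy
  rw [← chiSquaredCDF_sub_eq hn] at this
  linarith

/-! ### Sums of squares of independent standard normal variables -/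

lemma pi_withDensity_ofReal {ι : Type*} [Fintype ι] {f : ℝ → ℝ} (hf : Integrable f)
    (h0 : ∀ x, 0 ≤ f x) [SigmaFinite (volume.withDensity fun x => ENNReal.ofReal (f x))] :
    Measure.pi (fun _ : ι => volume.withDensity fun x => ENNReal.ofReal (f x)) =
      volume.withDensity fun x : ι → ℝ => ENNReal.ofReal (∏ i, f (x i)) := by
  refine Measure.pi_eq (μ := fun _ : ι => volume.withDensity fun x => ENNReal.ofReal (f x))
    fun s hs => ?_
  rw [withDensity_apply _ (MeasurableSet.univ_pi hs), volume_pi, Measure.restrict_pi_pi,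
    ← ofReal_integral_eq_lintegral_ofReal (Integrable.fintype_prod fun i => hf.restrict)
      (ae_of_all _ fun x => Finset.prod_nonneg fun i _ => h0 _),
    integral_fintype_prod_eq_prod (fun _ => f),
    ENNReal.ofReal_prod_of_nonneg fun i _ => integral_nonneg h0]
  refine Finset.prod_congr rfl fun i _ => ?_
  rw [withDensity_apply _ (hs i),
    ofReal_integral_eq_lintegral_ofReal hf.restrict (ae_of_all _ h0)]

lemma pi_gaussianReal_eq_withDensity (n : ℕ) :
    Measure.pi (fun _ : Fin n => gaussianReal 0 1) =
      volume.withDensity fun x : Fin n → ℝ => ENNReal.ofReal (∏ i, gaussianPDFReal 0 1 (x i)) := by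
  have h : gaussianReal 0 1 = volume.withDensity fun x => ENNReal.ofReal (gaussianPDFReal 0 1 x) :=
    gaussianReal_of_var_ne_zero 0 one_ne_zero
  have : SigmaFinite (volume.withDensity fun x => ENNReal.ofReal (gaussianPDFReal 0 1 x)) := by
    rw [← h]; infer_instance
  rw [← pi_withDensity_ofReal (integrable_gaussianPDFReal 0 1) (gaussianPDFReal_nonneg 0 1)]
  simp only [h]

lemma prod_gaussianPDFReal {n : ℕ} (x : Fin n → ℝ) :
    ∏ i, gaussianPDFReal 0 1 (x i) =
      (1 / √(2 * Real.pi)) ^ n * Real.exp (-‖WithLp.toLp 2 x‖ ^ 2 / 2) := by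
  simp only [gaussianPDFReal_zero_one, Finset.prod_mul_distrib, Finset.prod_const,
    Finset.card_univ, Fintype.card_fin, ← Real.exp_sum, EuclideanSpace.real_norm_sq_eq]
  rw [← Finset.sum_div, Finset.sum_neg_distrib]

/-- The joint density depends only on the norm, so polar coordinates reduce the integral to one over
r, and u = r² gives the χ² density up to a constant. Its value is not needed here. -/
lemma pi_gaussianReal_real_sum_sq_le_eq_const_mul {n : ℕ} (hn : n ≠ 0) :
    ∃ c : ℝ, ∀ x : ℝ,
      (Measure.pi fun _ : Fin n => gaussianReal 0 1).real {w | ∑ i, w i ^ 2 ≤ x} =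
        c * chiSquaredCDF n x := by
  have : Nonempty (Fin n) := Fin.pos_iff_nonempty.1 (Nat.pos_of_ne_zero hn)
  obtain ⟨c, hc⟩ : ∃ c : ℝ, ∀ F : ℝ → ℝ,
      ∫ w : EuclideanSpace ℝ (Fin n), F (‖w‖ ^ 2) =
        c * ∫ u in Set.Ioi (0 : ℝ), (u / 2) ^ (((n : ℝ) - 2) / 2) * F u := by
    -- n times the volume of the unit ball is the area of the unit sphere; the other factor comes
    -- from r^(n-1) dr = (2^((n-2)/2) / 2) (u/2)^((n-2)/2) du.
    refine ⟨n * volume.real (Metric.ball (0 : EuclideanSpace ℝ (Fin n)) 1) *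
      (2 ^ (((n : ℝ) - 2) / 2) / 2), fun F => ?_⟩
    rw [integral_fun_norm_addHaar volume (fun r => F (r ^ 2)),
      ← integral_comp_rpow_Ioi_of_pos (p := 2) (by norm_num)
        (g := fun u => (u / 2) ^ (((n : ℝ) - 2) / 2) * F u)]
    simp only [finrank_euclideanSpace_fin, nsmul_eq_mul, smul_eq_mul]
    rw [mul_assoc, mul_assoc]
    congr 2
    rw [← integral_const_mul]
    refine setIntegral_congr_fun measurableSet_Ioi fun r hr => ?_
    have hr : 0 < r := hr
    have e1 : (r ^ 2 / 2) ^ (((n : ℝ) - 2) / 2) = r ^ ((n : ℝ) - 2) / 2 ^ (((n : ℝ) - 2) / 2) := by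
      rw [Real.div_rpow (by positivity) (by norm_num), ← Real.rpow_natCast r 2,
        ← Real.rpow_mul hr.le]
      congr 2
      push_cast
      ring
    have e2 : r ^ (n - 1) = r ^ ((n : ℝ) - 2) * r := by
      rw [← Real.rpow_natCast, ← Real.rpow_add_one hr.ne', Nat.cast_sub (Nat.one_le_iff_ne_zero.2 hn)]
      congr 1
      push_cast
      ring
    have e3 : (r : ℝ) ^ (2 : ℝ) = r ^ 2 := by norm_cast
    have e4 : r ^ ((2 : ℝ) - 1) = r := by norm_num
    have : (0 : ℝ) < 2 ^ (((n : ℝ) - 2) / 2) := by positivity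
    simp only [e3, e4, e1, e2]
    field_simp
  have hG : 0 < Real.Gamma ((n : ℝ) / 2) := Real.Gamma_pos_of_pos (by positivity)
  refine ⟨(1 / √(2 * Real.pi)) ^ n * c * (2 * Real.Gamma ((n : ℝ) / 2)), fun x => ?_⟩
  have hm : MeasurableSet {w : Fin n → ℝ | ∑ i, w i ^ 2 ≤ x} :=
    measurableSet_le (by fun_prop) measurable_const
  have hint : Integrable fun w : Fin n → ℝ => ∏ i, gaussianPDFReal 0 1 (w i) :=
    Integrable.fintype_prod fun _ => integrable_gaussianPDFReal 0 1
  have hnn : ∀ w : Fin n → ℝ, 0 ≤ ∏ i, gaussianPDFReal 0 1 (w i) :=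
    fun w => Finset.prod_nonneg fun i _ => gaussianPDFReal_nonneg 0 1 _
  rw [pi_gaussianReal_eq_withDensity, Measure.real, withDensity_apply _ hm,
    ← ofReal_integral_eq_lintegral_ofReal hint.restrict (ae_of_all _ hnn),
    ENNReal.toReal_ofReal (integral_nonneg hnn), ← integral_indicator hm]
  let F : ℝ → ℝ := fun u => (1 / √(2 * Real.pi)) ^ n *
    Set.indicator (Set.Iic x) (fun u => Real.exp (-u / 2)) u
  have key : ∀ w : Fin n → ℝ, Set.indicator {w : Fin n → ℝ | ∑ i, w i ^ 2 ≤ x}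
      (fun w => ∏ i, gaussianPDFReal 0 1 (w i)) w =
      (fun v : EuclideanSpace ℝ (Fin n) => F (‖v‖ ^ 2)) (WithLp.toLp 2 w) := by
    intro w
    simp only [F, Set.indicator, Set.mem_ofPred_eq, Set.mem_Iic, prod_gaussianPDFReal,
      EuclideanSpace.real_norm_sq_eq]
    split_ifs <;> simp
  simp only [key]
  refine (((PiLp.volume_preserving_toLp (Fin n)).integral_comp
    (MeasurableEquiv.toLp 2 (Fin n → ℝ)).measurableEmbedding
    (fun v => F (‖v‖ ^ 2))).trans (hc F)).trans ?_
  have : ∫ u in Set.Ioi (0 : ℝ), (u / 2) ^ (((n : ℝ) - 2) / 2) * F u = (1 / √(2 * Real.pi)) ^ n *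
      ∫ u in Set.Ioc 0 x, (u / 2) ^ (((n : ℝ) - 2) / 2) * Real.exp (-u / 2) := by
    rw [← integral_const_mul, ← integral_indicator measurableSet_Ioi,
      ← integral_indicator measurableSet_Ioc]
    congr 1
    ext u
    by_cases h1 : 0 < u <;> by_cases h2 : u ≤ x <;> simp [F, Set.indicator, h1, h2]
    ring
  rw [this, chiSquaredCDF]
  field_simp

-- Both sides tend to 1 at infinity, which forces the unknown constant to be 1.
open Filter Topology in
lemma pi_gaussianReal_real_sum_sq_le {n : ℕ} (hn : n ≠ 0) (x : ℝ) :
    (Measure.pi fun _ : Fin n => gaussianReal 0 1).real {w | ∑ i, w i ^ 2 ≤ x} =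
      chiSquaredCDF n x := by
  obtain ⟨c, hc⟩ := pi_gaussianReal_real_sum_sq_le_eq_const_mul hn
  have h1 : Tendsto (fun x => c * chiSquaredCDF n x) atTop (𝓝 (c * 1)) :=
    (tendsto_chiSquaredCDF_atTop hn).const_mul c
  simp only [← hc] at h1
  have hm : Measurable fun w : Fin n → ℝ => ∑ i, w i ^ 2 := by fun_prop
  have := Measure.isProbabilityMeasure_map (μ := Measure.pi fun _ : Fin n => gaussianReal 0 1)
    hm.aemeasurable
  have h2 := tendsto_cdf_atTop ((Measure.pi fun _ : Fin n => gaussianReal 0 1).map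
    fun w => ∑ i, w i ^ 2)
  simp only [funext (cdf_eq_real _), map_measureReal_apply hm measurableSet_Iic] at h2
  have : c * 1 = 1 := tendsto_nhds_unique h1 h2
  rw [hc, ← mul_one c, this, one_mul]

/-! ### Joint law of the mean and the squared deviations -/

lemma exists_orthonormalBasis_apply_zero_eq_const (n : ℕ) :
    ∃ b : OrthonormalBasis (Fin (n + 1)) ℝ (EuclideanSpace ℝ (Fin (n + 1))),
      b 0 = WithLp.toLp 2 (fun _ => 1 / √((n : ℝ) + 1)) := by
  let v : Fin (n + 1) → EuclideanSpace ℝ (Fin (n + 1)) :=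
    fun _ => WithLp.toLp 2 (fun _ => 1 / √((n : ℝ) + 1))
  have hv : Orthonormal ℝ (Set.domRestrict {(0 : Fin (n + 1))} v) := by
    refine ⟨fun i => ?_, fun i j hij => absurd (Subsingleton.elim i j) hij⟩
    rw [← sq_eq_sq₀ (norm_nonneg _) zero_le_one, EuclideanSpace.real_norm_sq_eq]
    have : (0 : ℝ) < n + 1 := by positivity
    simp [v, Set.domRestrict, Real.sq_sqrt this.le, this.ne']
  obtain ⟨b, hb⟩ := hv.exists_orthonormalBasis_extension_of_card_eq (by simp)
  exact ⟨b, hb 0 rfl⟩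

/-- Rotation invariance: the standard Gaussian is the same whether its coordinates are taken in `b`
or in the standard basis. -/
lemma measurePreserving_orthonormalBasis {ι : Type*} [Fintype ι]
    (b : OrthonormalBasis ι ℝ (EuclideanSpace ℝ ι)) :
    MeasurePreserving (fun w : ι → ℝ => WithLp.ofLp (∑ i, w i • b i))
      (Measure.pi fun _ => gaussianReal 0 1) (Measure.pi fun _ => gaussianReal 0 1) := by
  have hm : Measurable fun w : ι → ℝ => ∑ i, w i • b i := by fun_prop
  have ho : Measurable (WithLp.ofLp : EuclideanSpace ℝ ι → ι → ℝ) := by fun_prop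
  refine ⟨by fun_prop, ?_⟩
  have h1 := stdGaussian_eq_map_pi_orthonormalBasis b
  rw [← map_pi_eq_stdGaussian] at h1
  have h2 := congrArg (Measure.map (WithLp.ofLp : EuclideanSpace ℝ ι → ι → ℝ)) h1
  rw [Measure.map_map ho (by fun_prop), Measure.map_map ho hm] at h2
  rw [show (fun w : ι → ℝ => WithLp.ofLp (∑ i, w i • b i)) =
    WithLp.ofLp ∘ fun w : ι → ℝ => ∑ i, w i • b i from rfl, ← h2]
  exact Measure.map_id

lemma sum_sub_sampleMean_sq {n : ℕ} (z : Fin (n + 1) → ℝ) :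
    ∑ k, (z k - sampleMean z) ^ 2 = ∑ k, z k ^ 2 - (n + 1) * sampleMean z ^ 2 := by
  have h : ∑ k, z k = (n + 1) * sampleMean z := by
    have : (0 : ℝ) < n + 1 := by positivity
    simp only [sampleMean]
    push_cast
    field_simp
  have e : ∀ k, (z k - sampleMean z) ^ 2 = z k ^ 2 - 2 * sampleMean z * z k + sampleMean z ^ 2 :=
    fun k => by ring
  simp only [e, Finset.sum_add_distrib, Finset.sum_sub_distrib, ← Finset.mul_sum, h,
    Finset.sum_const, Finset.card_univ, Fintype.card_fin, nsmul_eq_mul]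
  push_cast
  ring

lemma sampleMean_orthonormalBasis {n : ℕ}
    {b : OrthonormalBasis (Fin (n + 1)) ℝ (EuclideanSpace ℝ (Fin (n + 1)))}
    (hb : b 0 = WithLp.toLp 2 (fun _ => 1 / √((n : ℝ) + 1))) (w : Fin (n + 1) → ℝ) :
    sampleMean (WithLp.ofLp (∑ i, w i • b i)) = w 0 / √((n : ℝ) + 1) := by
  set z : EuclideanSpace ℝ (Fin (n + 1)) := ∑ i, w i • b i with hz
  have h1 : inner ℝ (b 0) z = w 0 := b.orthonormal.inner_right_fintype w 0
  have hp : (0 : ℝ) < n + 1 := by positivity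
  have hs : 0 < √((n : ℝ) + 1) := Real.sqrt_pos.2 hp
  have hss : √((n : ℝ) + 1) * √((n : ℝ) + 1) = n + 1 := Real.mul_self_sqrt hp.le
  rw [hb, PiLp.inner_apply] at h1
  simp only [RCLike.inner_apply, conj_trivial, ← Finset.sum_mul] at h1
  rw [← h1, sampleMean]
  push_cast
  rw [mul_one_div, div_div, hss]
  ring

lemma sum_sub_sampleMean_sq_orthonormalBasis {n : ℕ}
    {b : OrthonormalBasis (Fin (n + 1)) ℝ (EuclideanSpace ℝ (Fin (n + 1)))}
    (hb : b 0 = WithLp.toLp 2 (fun _ => 1 / √((n : ℝ) + 1))) (w : Fin (n + 1) → ℝ) :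
    ∑ k, (WithLp.ofLp (∑ i, w i • b i) k - sampleMean (WithLp.ofLp (∑ i, w i • b i))) ^ 2 =
      ∑ i : Fin n, w i.succ ^ 2 := by
  have hp : (0 : ℝ) < n + 1 := by positivity
  have hn : ∑ k, (WithLp.ofLp (∑ i, w i • b i) k) ^ 2 = ∑ i, w i ^ 2 := by
    rw [← EuclideanSpace.real_norm_sq_eq, ← real_inner_self_eq_norm_sq,
      b.orthonormal.inner_sum]
    simp [sq]
  rw [sum_sub_sampleMean_sq, hn, sampleMean_orthonormalBasis hb, div_pow, Real.sq_sqrt hp.le,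
    Fin.sum_univ_succ]
  field_simp
  ring

lemma measurable_sampleMean {N : ℕ} : Measurable (sampleMean (N := N)) := by
  unfold sampleMean
  fun_prop

lemma measurable_sampleSD {N : ℕ} : Measurable (sampleSD (N := N)) := by
  have := measurable_sampleMean (N := N)
  unfold sampleSD
  fun_prop

/-- Independence is encoded by the product measure on the right: the mean uses only coordinate 0 of
the rotated sample, the squared deviations only the others. -/
lemma map_sampleMean_sum_sq (n : ℕ) :
    (Measure.pi fun _ : Fin (n + 1) => gaussianReal 0 1).map
        (fun z => (sampleMean z, ∑ k, (z k - sampleMean z) ^ 2)) =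
      ((gaussianReal 0 1).prod (Measure.pi fun _ : Fin n => gaussianReal 0 1)).map
        (fun p => (p.1 / √((n : ℝ) + 1), ∑ i, p.2 i ^ 2)) := by
  obtain ⟨b, hb⟩ := exists_orthonormalBasis_apply_zero_eq_const n
  have hT := measurePreserving_orthonormalBasis b
  have := measurable_sampleMean (N := n + 1)
  have hm : Measurable fun z : Fin (n + 1) → ℝ =>
    (sampleMean z, ∑ k, (z k - sampleMean z) ^ 2) := by fun_prop
  have hS := measurePreserving_piFinSuccAbove (fun _ : Fin (n + 1) => gaussianReal 0 1) 0
  rw [← hT.map_eq, Measure.map_map hm hT.measurable, ← hS.map_eq,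
    Measure.map_map (by fun_prop) hS.measurable]
  congr 1
  ext w
  · simp only [Function.comp_apply, sampleMean_orthonormalBasis hb]
    rfl
  · simp only [Function.comp_apply, sum_sub_sampleMean_sq_orthonormalBasis hb]
    rfl

/-! ### Reduction to a standard normal sample -/

lemma content_eq_normalMass {N : ℕ} {m σ lam : ℝ} (hσ : 0 < σ) (hl : 0 < lam) (y : Fin N → ℝ) :
    content m σ lam y = normalMass ((sampleMean y - m) / σ) (lam * sampleSD y / σ) := by
  have h0 : 0 ≤ sampleSD y := Real.sqrt_nonneg _
  rw [← gaussianReal_real_Icc_eq_normalMass _ (by positivity), ← gaussianReal_real_Icc (m := m) hσ,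
    content]
  congr 2 <;> field_simp <;> ring

lemma sampleMean_affine {N : ℕ} (hN : N ≠ 0) (m σ : ℝ) (z : Fin N → ℝ) :
    sampleMean (fun k => m + σ * z k) = m + σ * sampleMean z := by
  have : (0 : ℝ) < N := by positivity
  simp only [sampleMean, Finset.sum_add_distrib, Finset.sum_const, Finset.card_univ,
    Fintype.card_fin, nsmul_eq_mul, ← Finset.mul_sum]
  field_simp

lemma sampleSD_affine {N : ℕ} (hN : N ≠ 0) (m : ℝ) {σ : ℝ} (hσ : 0 ≤ σ) (z : Fin N → ℝ) :
    sampleSD (fun k => m + σ * z k) = σ * sampleSD z := by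
  have e : ∀ k, (m + σ * z k - (m + σ * sampleMean z)) ^ 2 = σ ^ 2 * (z k - sampleMean z) ^ 2 :=
    fun k => by ring
  simp only [sampleSD, sampleMean_affine hN, e, ← Finset.mul_sum]
  rw [mul_left_comm, Real.sqrt_mul (sq_nonneg σ), Real.sqrt_sq hσ]

lemma IsNormalSample.map_eq {Ω : Type u} [MeasurableSpace Ω] {P : Measure Ω} {N : ℕ}
    {y : Fin N → Ω → ℝ} {m σ : ℝ} (h : IsNormalSample P y m σ) :
    P.map (fun ω k => y k ω) =
      (Measure.pi fun _ => gaussianReal 0 1).map (fun z k => m + σ * z k) := by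
  have := h.isProbabilityMeasure
  have hy : ∀ k, AEMeasurable (y k) P := fun k => (h.hasLaw k).aemeasurable
  rw [(iIndepFun_iff_map_fun_eq_pi_map hy).1 h.indep]
  simp only [(h.hasLaw _).map_eq, gaussianReal_eq_map]
  have : IsProbabilityMeasure ((gaussianReal 0 1).map fun x => m + σ * x) :=
    Measure.isProbabilityMeasure_map (by fun_prop)
  exact (Measure.pi_map_pi (f := fun _ x => m + σ * x) (fun _ => by fun_prop)).symm

lemma IsNormalSample.real_lt_content {Ω : Type u} [MeasurableSpace Ω] {P : Measure Ω} {N : ℕ}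
    (hN : N ≠ 0) {y : Fin N → Ω → ℝ} {m σ : ℝ} (h : IsNormalSample P y m σ) {lam γ : ℝ}
    (hl : 0 < lam) (hγ0 : 0 < γ) (hγ1 : γ < 1) :
    P.real {ω | γ < content m σ lam (fun k => y k ω)} =
      (Measure.pi fun _ : Fin N => gaussianReal 0 1).real
        {z | halfWidth (sampleMean z) γ < lam * sampleSD z} := by
  have hσ := h.sd_pos
  have hmean := measurable_sampleMean (N := N)
  have hsd := measurable_sampleSD (N := N)
  have hm : MeasurableSet {y : Fin N → ℝ | γ < content m σ lam y} := by
    simp only [content_eq_normalMass hσ hl]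
    have : Measurable fun y : Fin N → ℝ => ((sampleMean y - m) / σ, lam * sampleSD y / σ) := by
      fun_prop
    exact measurableSet_lt measurable_const (continuous_normalMass.measurable.comp this)
  have hy : AEMeasurable (fun ω k => y k ω) P :=
    aemeasurable_pi_lambda _ fun k => (h.hasLaw k).aemeasurable
  have e1 : P.real {ω | γ < content m σ lam (fun k => y k ω)} =
      (P.map (fun ω k => y k ω)).real {y : Fin N → ℝ | γ < content m σ lam y} := by
    rw [map_measureReal_apply_of_aemeasurable hy hm]
    rfl
  rw [e1, h.map_eq, map_measureReal_apply (by fun_prop) hm]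
  congr 1
  ext z
  simp only [Set.mem_preimage, Set.mem_ofPred_eq, content_eq_normalMass hσ hl,
    sampleMean_affine hN, sampleSD_affine hN m hσ.le, lt_normalMass_iff _ _ hγ0 hγ1]
  have a1 : (m + σ * sampleMean z - m) / σ = sampleMean z := by field_simp; ring
  have a2 : lam * (σ * sampleSD z) / σ = lam * sampleSD z := by field_simp
  rw [a1, a2]

lemma measurableSet_halfWidth_lt {γ : ℝ} (hγ0 : 0 < γ) (hγ1 : γ < 1) {α : Type*}
    [MeasurableSpace α] {f g : α → ℝ} (hf : Measurable f) (hg : Measurable g) :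
    MeasurableSet {a | halfWidth (f a) γ < g a} :=
  measurableSet_lt ((measurable_halfWidth hγ0 hγ1).comp hf) hg

/-! ### Integration over the mean -/

lemma le_mul_sq_div_iff {c lam q r : ℝ} (hc : 0 < c) (hl : 0 < lam) (hq : 0 < q) :
    r ≤ c * (q / lam) ^ 2 ↔ ¬ q < lam * √(1 / c * r) := by
  have e : lam * √(1 / c * r) ≤ q ↔ √(1 / c * r) ≤ q / lam := by
    rw [le_div_iff₀ hl, mul_comm]
  rw [not_lt, e, Real.sqrt_le_left (by positivity), one_div, inv_mul_le_iff₀ hc]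

/-- Fubini: with the mean fixed, the complementary event bounds the sum of squares from above, so
its probability is a value of the χ² distribution function. -/
lemma pi_gaussianReal_real_halfWidth_lt {n : ℕ} (hn : n ≠ 0) {lam γ : ℝ} (hl : 0 < lam)
    (hγ0 : 0 < γ) (hγ1 : γ < 1) :
    (Measure.pi fun _ : Fin (n + 1) => gaussianReal 0 1).real
        {z | halfWidth (sampleMean z) γ < lam * sampleSD z} =
      1 - ∫ a, chiSquaredCDF n (n * (halfWidth (a / √((n : ℝ) + 1)) γ / lam) ^ 2)
        ∂(gaussianReal 0 1) := by
  have hn' : (0 : ℝ) < n := by positivity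
  have := measurable_sampleMean (N := n + 1)
  set π := Measure.pi fun _ : Fin n => gaussianReal 0 1
  let S : Set (ℝ × ℝ) := {p | halfWidth p.1 γ < lam * √(1 / (n : ℝ) * p.2)}
  have hS : MeasurableSet S := measurableSet_halfWidth_lt hγ0 hγ1 (by fun_prop) (by fun_prop)
  have hf : Measurable fun p : ℝ × (Fin n → ℝ) => (p.1 / √((n : ℝ) + 1), ∑ i, p.2 i ^ 2) := by
    fun_prop
  have e1 : (Measure.pi fun _ : Fin (n + 1) => gaussianReal 0 1).real
        {z | halfWidth (sampleMean z) γ < lam * sampleSD z} =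
      ((gaussianReal 0 1).prod π).real
        ((fun p => (p.1 / √((n : ℝ) + 1), ∑ i, p.2 i ^ 2)) ⁻¹' S) := by
    rw [← map_measureReal_apply hf hS, ← map_sampleMean_sum_sq,
      map_measureReal_apply (by fun_prop) hS]
    congr 1
    ext z
    simp [S, sampleSD]
  have hT : MeasurableSet
      ((fun p : ℝ × (Fin n → ℝ) => (p.1 / √((n : ℝ) + 1), ∑ i, p.2 i ^ 2)) ⁻¹' S) := hf hS
  rw [e1, ← compl_compl ((fun p : ℝ × (Fin n → ℝ) =>
    (p.1 / √((n : ℝ) + 1), ∑ i, p.2 i ^ 2)) ⁻¹' S), probReal_compl_eq_one_sub hT.compl]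
  congr 1
  rw [Measure.real, Measure.prod_apply hT.compl, ← integral_toReal
    (measurable_measure_prodMk_left hT.compl).aemeasurable (ae_of_all _ fun _ => measure_lt_top _ _)]
  refine integral_congr_ae (ae_of_all _ fun a => ?_)
  refine Eq.trans ?_ (pi_gaussianReal_real_sum_sq_le hn _)
  change π.real _ = π.real _
  congr 1
  ext w
  simp only [S, Set.mem_preimage, Set.mem_compl_iff, Set.mem_ofPred_eq]
  exact (le_mul_sq_div_iff hn' hl (halfWidth_pos _ hγ0 hγ1)).symm

lemma integral_gaussianReal_comp_div_sqrt (f : ℝ → ℝ) {c : ℝ} (hc : 0 < c) :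
    ∫ a, f (a / √c) ∂(gaussianReal 0 1) =
      √(c / (2 * Real.pi)) * ∫ μ, f μ * Real.exp (-c * μ ^ 2 / 2) := by
  have hs : 0 < √c := Real.sqrt_pos.2 hc
  have h : ∀ a, gaussianPDFReal 0 1 a • f (a / √c) =
      (fun μ => 1 / √(2 * Real.pi) * (f μ * Real.exp (-c * μ ^ 2 / 2))) (a / √c) := by
    intro a
    have : -c * (a / √c) ^ 2 / 2 = -a ^ 2 / 2 := by
      rw [div_pow, Real.sq_sqrt hc.le]
      field_simp
    simp only [this, gaussianPDFReal_zero_one, smul_eq_mul]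
    ring
  rw [integral_gaussianReal_eq_integral_smul one_ne_zero]
  refine ((integral_congr_ae (ae_of_all _ h)).trans (Measure.integral_comp_div
    (fun μ => 1 / √(2 * Real.pi) * (f μ * Real.exp (-c * μ ^ 2 / 2))) √c)).trans ?_
  rw [integral_const_mul, abs_of_pos hs, smul_eq_mul,
    Real.sqrt_div hc.le]
  ring

/-! ### Dependence of `W` on λ -/

/-- Writing λ⁻¹ instead of a quotient prepares for the variable t = λ⁻¹, in which the integral also
makes sense at t = 0. -/
lemma W_eq_one_sub_integral (n : ℕ) (lam γ : ℝ) :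
    W lam γ (n + 1) = 1 - ∫ a, chiSquaredCDF n
      (n * (halfWidth (a / √((n : ℝ) + 1)) γ * lam⁻¹) ^ 2) ∂(gaussianReal 0 1) := by
  rw [integral_gaussianReal_comp_div_sqrt
    (fun μ => chiSquaredCDF n (n * (halfWidth μ γ * lam⁻¹) ^ 2)) (by positivity), W]
  simp [integrandW, div_eq_mul_inv]

lemma measurable_chiSquaredCDF_comp {n : ℕ} (hn : n ≠ 0) {α : Type*} [MeasurableSpace α]
    {Q : α → ℝ} (hQ : Measurable Q) (c t : ℝ) :
    Measurable fun a => chiSquaredCDF n (c * (Q a * t) ^ 2) :=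
  (continuous_chiSquaredCDF hn).measurable.comp (by fun_prop)

lemma norm_chiSquaredCDF_le_one {n : ℕ} (hn : n ≠ 0) (x : ℝ) : ‖chiSquaredCDF n x‖ ≤ 1 := by
  rw [Real.norm_of_nonneg (chiSquaredCDF_nonneg hn x)]
  exact chiSquaredCDF_le_one hn x

lemma integrable_integrandW {N : ℕ} (hN : 2 ≤ N) {γ : ℝ} (hγ0 : 0 < γ) (hγ1 : γ < 1) (lam : ℝ) :
    Integrable (integrandW lam γ N) := by
  have hn : N - 1 ≠ 0 := by omega
  have hN' : (0 : ℝ) < N := by positivity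
  have he : Integrable fun μ : ℝ => Real.exp (-(N : ℝ) * μ ^ 2 / 2) := by
    have := integrable_exp_neg_mul_sq (b := (N : ℝ) / 2) (by positivity)
    refine this.congr (ae_of_all _ fun μ => ?_)
    ring_nf
  refine he.bdd_mul (c := 1) ?_ (ae_of_all _ fun μ => norm_chiSquaredCDF_le_one hn _)
  simp only [div_eq_mul_inv]
  exact (measurable_chiSquaredCDF_comp hn (measurable_halfWidth hγ0 hγ1) _ _).aestronglyMeasurable

section Mixture

variable {α : Type*} [MeasurableSpace α] {ν : Measure α} [IsProbabilityMeasure ν] {n : ℕ}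
  {Q : α → ℝ}

lemma integrable_chiSquaredCDF_comp (hn : n ≠ 0) (hQ : Measurable Q) (t : ℝ) :
    Integrable (fun a => chiSquaredCDF n (n * (Q a * t) ^ 2)) ν :=
  Integrable.of_bound (measurable_chiSquaredCDF_comp hn hQ _ _).aestronglyMeasurable 1
    (ae_of_all _ fun _ => norm_chiSquaredCDF_le_one hn _)

/-- Dominated convergence with the constant bound 1, integrable because `ν` is a probability
measure. -/
lemma continuous_integral_chiSquaredCDF (hn : n ≠ 0) (hQ : Measurable Q) :
    Continuous fun t => ∫ a, chiSquaredCDF n (n * (Q a * t) ^ 2) ∂ν := by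
  refine continuous_of_dominated (bound := fun _ => 1)
    (fun t => (measurable_chiSquaredCDF_comp hn hQ _ _).aestronglyMeasurable)
    (fun t => ae_of_all _ fun _ => norm_chiSquaredCDF_le_one hn _) (integrable_const _)
    (ae_of_all _ fun a => (continuous_chiSquaredCDF hn).comp (by fun_prop))

open Filter Topology in
lemma tendsto_integral_chiSquaredCDF (hn : n ≠ 0) (hQ : Measurable Q) (hQ0 : ∀ a, 0 < Q a) :
    Tendsto (fun t => ∫ a, chiSquaredCDF n (n * (Q a * t) ^ 2) ∂ν) atTop (𝓝 1) := by
  have h1 : ∫ _, (1 : ℝ) ∂ν = 1 := by simp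
  rw [← h1]
  refine tendsto_integral_filter_of_dominated_convergence (fun _ => 1)
    (.of_forall fun t => (measurable_chiSquaredCDF_comp hn hQ _ _).aestronglyMeasurable)
    (.of_forall fun t => ae_of_all _ fun _ => norm_chiSquaredCDF_le_one hn _) (integrable_const _)
    (ae_of_all _ fun a => (tendsto_chiSquaredCDF_atTop hn).comp ?_)
  have hn' : (0 : ℝ) < n := by positivity
  exact ((tendsto_pow_atTop two_ne_zero).comp
    (tendsto_id.const_mul_atTop (hQ0 a))).const_mul_atTop hn'

lemma strictMonoOn_integral_chiSquaredCDF (hn : n ≠ 0) (hQ : Measurable Q) (hQ0 : ∀ a, 0 < Q a) :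
    StrictMonoOn (fun t => ∫ a, chiSquaredCDF n (n * (Q a * t) ^ 2) ∂ν) (Set.Ici 0) := by
  intro s hs t _ hst
  have hs : 0 ≤ s := hs
  have hn' : (0 : ℝ) < n := by positivity
  have hlt : ∀ a, 0 < chiSquaredCDF n (n * (Q a * t) ^ 2) - chiSquaredCDF n (n * (Q a * s) ^ 2) := by
    intro a
    have hq := hQ0 a
    refine sub_pos.2 (strictMonoOn_chiSquaredCDF hn ?_ ?_ ?_)
    · exact Set.mem_Ici.2 (by positivity)
    · exact Set.mem_Ici.2 (by positivity)
    · gcongr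
  have hi := fun t => integrable_chiSquaredCDF_comp (ν := ν) hn hQ t
  rw [← sub_pos]
  simp only
  rw [← integral_sub (hi t) (hi s), integral_pos_iff_support_of_nonneg (fun a => (hlt a).le)
    ((hi t).sub (hi s))]
  have : (Function.support fun a =>
      chiSquaredCDF n (n * (Q a * t) ^ 2) - chiSquaredCDF n (n * (Q a * s) ^ 2)) = Set.univ :=
    Set.eq_univ_of_forall fun a => (hlt a).ne'
  rw [this, measure_univ]
  exact one_pos

lemma exists_integral_chiSquaredCDF_eq (hn : n ≠ 0) (hQ : Measurable Q) (hQ0 : ∀ a, 0 < Q a)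
    {β : ℝ} (hβ0 : 0 < β) (hβ1 : β < 1) :
    ∃ t, 0 < t ∧ ∫ a, chiSquaredCDF n (n * (Q a * t) ^ 2) ∂ν = β := by
  have h0 : ∫ a, chiSquaredCDF n (n * (Q a * 0) ^ 2) ∂ν = 0 := by simp [chiSquaredCDF_zero]
  obtain ⟨T, hT, hT0⟩ := (((tendsto_integral_chiSquaredCDF (ν := ν) hn hQ hQ0).eventually_const_lt
    hβ1).and (Filter.eventually_ge_atTop 0)).exists
  obtain ⟨t, ht, he⟩ := intermediate_value_Icc hT0
    (continuous_integral_chiSquaredCDF (ν := ν) hn hQ).continuousOn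
    (show β ∈ Set.Icc _ _ from ⟨h0.le.trans hβ0.le, hT.le⟩)
  -- t = 0 is excluded because the integral vanishes there while `β` is positive.
  refine ⟨t, lt_of_le_of_ne ht.1 ?_, he⟩
  rintro rfl
  exact hβ0.ne (h0.symm.trans he)

end Mixture

lemma measurable_halfWidth_div {γ : ℝ} (hγ0 : 0 < γ) (hγ1 : γ < 1) (c : ℝ) :
    Measurable fun a => halfWidth (a / c) γ :=
  (measurable_halfWidth hγ0 hγ1).comp (measurable_id.div_const c)

/-- Two order reversals cancel: λ ↦ λ⁻¹ and the subtraction from 1. -/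
lemma strictMonoOn_W {n : ℕ} (hn : n ≠ 0) {γ : ℝ} (hγ0 : 0 < γ) (hγ1 : γ < 1) :
    StrictMonoOn (fun lam => W lam γ (n + 1)) (Set.Ioi 0) := by
  intro s hs t ht hst
  have hs : 0 < s := hs
  have ht : 0 < t := ht
  have := strictMonoOn_integral_chiSquaredCDF (ν := gaussianReal 0 1) hn
    (measurable_halfWidth_div hγ0 hγ1 √((n : ℝ) + 1)) (fun a => halfWidth_pos _ hγ0 hγ1)
    (Set.mem_Ici.2 (inv_nonneg.2 ht.le)) (Set.mem_Ici.2 (inv_nonneg.2 hs.le))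
    (inv_strictAnti₀ hs hst)
  simp only at this
  simp only [W_eq_one_sub_integral]
  linarith

lemma exists_W_eq {n : ℕ} (hn : n ≠ 0) {γ β : ℝ} (hγ0 : 0 < γ) (hγ1 : γ < 1)
    (hβ0 : 0 < β) (hβ1 : β < 1) : ∃ lam, 0 < lam ∧ W lam γ (n + 1) = β := by
  obtain ⟨t, ht, he⟩ := exists_integral_chiSquaredCDF_eq (ν := gaussianReal 0 1) hn
    (measurable_halfWidth_div hγ0 hγ1 √((n : ℝ) + 1)) (fun a => halfWidth_pos _ hγ0 hγ1)
    (β := 1 - β) (by linarith) (by linarith)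
  refine ⟨t⁻¹, inv_pos.2 ht, ?_⟩
  rw [W_eq_one_sub_integral, inv_inv, he]
  ring

lemma IsNormalSample.real_lt_content_eq_W {Ω : Type u} [MeasurableSpace Ω] {P : Measure Ω} {n : ℕ}
    (hn : n ≠ 0) {y : Fin (n + 1) → Ω → ℝ} {m σ : ℝ} (h : IsNormalSample P y m σ) {lam γ : ℝ}
    (hl : 0 < lam) (hγ0 : 0 < γ) (hγ1 : γ < 1) :
    P.real {ω | γ < content m σ lam (fun k => y k ω)} = W lam γ (n + 1) := by
  rw [h.real_lt_content n.succ_ne_zero hl hγ0 hγ1, pi_gaussianReal_real_halfWidth_lt hn hl hγ0 hγ1,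
    W_eq_one_sub_integral]
  simp only [div_eq_mul_inv]

end NormalTolerance

theorem theorem3 (N : ℕ) (hN : 2 ≤ N) (γ : ℝ) (hγ0 : 0 < γ) (hγ1 : γ < 1) :
    -- `q(μ, γ)` is well defined: it is the only real root of its equation, and it is positive
    (∀ μ : ℝ, (∀ q : ℝ, NormalTolerance.normalMass μ q = γ ↔ q = NormalTolerance.halfWidth μ γ) ∧
      0 < NormalTolerance.halfWidth μ γ) ∧
    -- the integral in `W` converges
    (∀ lam : ℝ, 0 < lam → Integrable (NormalTolerance.integrandW lam γ N) volume) ∧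
    -- the probability that the content exceeds `γ` is `W`, for every normal sample
    (∀ (Ω : Type u) [MeasurableSpace Ω] (P : Measure Ω) (y : Fin N → Ω → ℝ) (m σ : ℝ),
      NormalTolerance.IsNormalSample P y m σ → ∀ lam : ℝ, 0 < lam →
        P.real {ω | γ < NormalTolerance.content m σ lam (fun k => y k ω)} =
          NormalTolerance.W lam γ N) ∧
    -- `W` is strictly increasing in `lam`
    StrictMonoOn (fun lam : ℝ => NormalTolerance.W lam γ N) (Set.Ioi 0) ∧
    -- `W = β` has exactly one positive root, and this root, which depends only on `β`, `γ`, `N`,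
    -- is the only value of `lam` that gives confidence level `β`, whatever `m` and `σ` are
    (∀ β : ℝ, 0 < β → β < 1 →
      ∃ lam₀ : ℝ, 0 < lam₀ ∧
        (∀ lam : ℝ, 0 < lam → (NormalTolerance.W lam γ N = β ↔ lam = lam₀)) ∧
        ∀ (Ω : Type u) [MeasurableSpace Ω] (P : Measure Ω) (y : Fin N → Ω → ℝ) (m σ : ℝ),
          NormalTolerance.IsNormalSample P y m σ → ∀ lam : ℝ, 0 < lam →
            (P.real {ω | γ < NormalTolerance.content m σ lam (fun k => y k ω)} = β ↔
              lam = lam₀)) := by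
  obtain ⟨n, rfl⟩ : ∃ n, N = n + 1 := ⟨N - 1, by omega⟩
  have hn : n ≠ 0 := by omega
  have hmono := NormalTolerance.strictMonoOn_W hn hγ0 hγ1
  refine ⟨fun μ => ⟨fun q => NormalTolerance.normalMass_eq_iff μ q hγ0 hγ1,
      NormalTolerance.halfWidth_pos μ hγ0 hγ1⟩,
    fun lam _ => NormalTolerance.integrable_integrandW hN hγ0 hγ1 lam,
    fun Ω _ P y m σ h lam hl => h.real_lt_content_eq_W hn hl hγ0 hγ1, hmono, ?_⟩
  intro β hβ0 hβ1
  obtain ⟨lam₀, h0, he⟩ := NormalTolerance.exists_W_eq hn hγ0 hγ1 hβ0 hβ1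
  have huniq : ∀ lam : ℝ, 0 < lam → (NormalTolerance.W lam γ (n + 1) = β ↔ lam = lam₀) :=
    fun lam hl => by
      rw [← he]
      exact hmono.injOn.eq_iff hl h0
  refine ⟨lam₀, h0, huniq, fun Ω _ P y m σ h lam hl => ?_⟩
  rw [h.real_lt_content_eq_W hn hl hγ0 hγ1]
  exact huniq lam hl
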